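/- Fix a first-order language $L$ with equality and infinitely many variables. Expressions are terms of $L$, Boolean expressions are quantifier-free formulas of $L$, and assertions are formulas of $L$. Statements are given by $$S ::= skip \mid \bar x:=\bar t \mid P(\bar t)\mid S;S\mid \mathbf{if}\ B\ \mathbf{then}\ S\ \mathbf{else}\ S\ \mathbf{fi}\mid \mathbf{while}\ B\ \mathbf{do}\ S\ \mathbf{od}\mid \mathbf{begin\ local}\ \bar x:=\bar t;\,S\ \mathbf{end},$$ where each $\bar x$ is a list of distinct variables. A program $(D\mid S)$ consists of a statement $S$ and a finite set $D=\{P_i(\bar u_i)::S_i\mid 1\le i\le n\}$ of (mutually recursive) procedure declarations, with distinct formal parameters $\bar u_i$, in which each procedure used in $S$ or in a body $S_i$ is declared exactly once, calls having the right number of arguments. For an interpretation $I$ of $L$ (with non-empty domain) the meaning of $(D\mid S)$ is the usual partial function on states. A block $\mathbf{begin\ local}\ \bar x:=\bar t;S\ \mathbf{end}$ executes $\bar x:=\bar t;S$ and then restores the initial values of $\bar x$, and the call $P_i(\bar t)$ means $\mathbf{begin\ local}\ \bar u_i:=\bar t;S_i\ \mathbf{end}$ (call-by-value, dynamic scope).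 A correctness formula $\{p\}S\{q\}$ is true in $I$, written $I\models\{p\}S\{q\}$, if every state reached by $(D\mid S)$ from a state satisfying $p$ satisfies $q$. $L$ is expressive relative to $I$ if for every assertion $p$ and program $(D\mid S)$ the set of states reachable by $(D\mid S)$ from states satisfying $p$ is defined by a formula of $L$. Let $var(D\mid S)$ be the set of variables occurring in $(D\mid S)$. Let $change(D\mid S)$ consist of the variables assigned in $S$, where local variables are removed at each block and a call of $P_i$ contributes $change(D)\setminus\{\bar u_i\}$; here $change(D)$ is the union over all $i$ of the same set for $S_i$ with calls contributing $\emptyset$. The proof system $CBV$ has the usual axioms for $skip$ and parallel assignment ($\{p[\bar x:=\bar t]\}\,\bar x:=\bar t\,\{p\}$), the usual rules for composition, conditional and while, the consequence rule, and the following rules. * BLOCK: from $\{p\}\bar x:=\bar t;S\{q\}$ infer $\{p\}\mathbf{begin\ local}\ \bar x:=\bar t;S\ \mathbf{end}\{q\}$, if $\{\bar x\}\cap free(q)=\emptyset$. * PROCEDURE CALL: from $\{p\}P_i(\bar u_i)\{q\}$ infer $\{p[\bar u_i:=\bar t]\}P_i(\bar t)\{q\}$, if $\{\bar u_i\}\cap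 free(q)=\emptyset$. * SUBSTITUTION: from $\{p\}S\{q\}$ infer $\{p[\bar x:=\bar y]\}S\{q[\bar x:=\bar y]\}$ ($\bar y$ a list of variables), if $\{\bar x\}\cap var(D\mid S)=\emptyset$ and $\{\bar y\}\cap change(D\mid S)=\emptyset$. * INVARIANCE: from $\{r\}S\{q\}$ infer $\{p\wedge r\}S\{p\wedge q\}$, if $free(p)\cap change(D\mid S)=\emptyset$. * $\exists$-INTRODUCTION: from $\{p\}S\{q\}$ infer $\{\exists\bar x:p\}S\{q\}$, if $\{\bar x\}\cap(var(D\mid S)\cup free(q))=\emptyset$. * RECURSION: infer $\{p\}S\{q\}$ if, from the assumptions $\{p_i\}P_i(\bar u_i)\{q_i\}$ $(1\le i\le n)$ with $\{\bar u_i\}\cap free(q_i)=\emptyset$, the formula $\{p\}S\{q\}$ and all the formulas $\{p_i\}S_i\{q_i\}$ $(1\le i\le n)$ are provable by the other axioms and rules. Write $\vdash^k_I\{p\}S\{q\}$ if $\{p\}S\{q\}$ has a proof in $CBV$, in which all assertions true in $I$ may be used as premises of the consequence rule, that consists of at most $k$ applications of axioms and proof rules (those in subsidiary proofs included). Define $l(skip)=l(\bar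 x:=\bar t)=l(P(\bar t))=1$, $l(S_1;S_2)=l(\mathbf{if}\ B\ \mathbf{then}\ S_1\ \mathbf{else}\ S_2\ \mathbf{fi})=l(S_1)+l(S_2)+1$, $l(\mathbf{while}\ B\ \mathbf{do}\ S\ \mathbf{od})=l(S)+1$, $l(\mathbf{begin\ local}\ \bar x:=\bar t;S\ \mathbf{end})=l(\bar x:=\bar t;S)+1$, and $l(D\mid S)=l(S)+\sum_{i=1}^n l(S_i)$. **Theorem.** There is an absolute constant $C$ such that the following holds. Let $I$ be an interpretation such that $L$ is expressive relative to $I$, let $(D\mid T)$ be a program, and let $p,q$ be assertions. If $I\models\{p\}T\{q\}$, then $\vdash_I^{\,C\cdot l(D\mid T)}\{p\}T\{q\}$. That is, $\vdash_I^{O(l(D\mid T))}\{p\}T\{q\}$. -/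

import Mathlib

universe u v w z

namespace CBV

open FirstOrder.Language

/- A list of `m` distinct variables is an injection `x : Fin m ↪ Var`; a list of `m` expressions is a
function `Fin m → L.Term Var`.  States are functions `Var → M`.  For a state `σ`, the simultaneous
update `σ[x := d]` is `Function.extend x d σ`. -/

/-- Assertions: first-order formulas of `L` (with equality) whose free variables are in `Var`. -/
abbrev Assertion (L : FirstOrder.Language.{u, v}) (Var : Type w) : Type (max u v w) := L.Formula Var

/-- Boolean expressions: quantifier-free formulas. -/
abbrev BoolExpr (L : FirstOrder.Language.{u, v}) (Var : Type w) : Type (max u v w) :=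
  {B : L.Formula Var // B.IsQF}

/-- Statements over `n` procedures, the `i`-th of which has `ar i` parameters. -/
inductive Stmt (L : FirstOrder.Language.{u, v}) (Var : Type w) {n : ℕ} (ar : Fin n → ℕ) :
    Type (max u v w) where
  | skip : Stmt L Var ar
  | assign {m : ℕ} (x : Fin m ↪ Var) (t : Fin m → L.Term Var) : Stmt L Var ar
  | call (i : Fin n) (t : Fin (ar i) → L.Term Var) : Stmt L Var ar
  | seq (S₁ S₂ : Stmt L Var ar) : Stmt L Var ar
  | ite (B : BoolExpr L Var) (S₁ S₂ : Stmt L Var ar) : Stmt L Var ar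
  | while (B : BoolExpr L Var) (S : Stmt L Var ar) : Stmt L Var ar
  /-- `begin local x := t; S end` -/
  | block {m : ℕ} (x : Fin m ↪ Var) (t : Fin m → L.Term Var) (S : Stmt L Var ar) : Stmt L Var ar

/-- A set of procedure declarations `P_i(u_i) :: S_i`, one for each procedure name `i : Fin n`. -/
structure Decls (L : FirstOrder.Language.{u, v}) (Var : Type w) {n : ℕ} (ar : Fin n → ℕ) :
    Type (max u v w) where
  /-- the formal parameters `u_i` -/
  params (i : Fin n) : Fin (ar i) ↪ Var
  /-- the body `S_i` -/
  body (i : Fin n) : Stmt L Var ar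

section Programs

variable {L : FirstOrder.Language.{u, v}} {Var : Type w} {n : ℕ} {ar : Fin n → ℕ}

/-- The generic call `P_i(u_i)`. -/
def Decls.genericCall (D : Decls L Var ar) (i : Fin n) : Stmt L Var ar :=
  .call i (fun j => Term.var (D.params i j))

/-- The substitution `[x := t]`, as a map from variables to expressions. -/
noncomputable def substMap {m : ℕ} (x : Fin m ↪ Var) (t : Fin m → L.Term Var) :
    Var → L.Term Var :=
  Function.extend x t Term.var

/-- The assertion `p[x := t]`. -/
noncomputable def Assertion.substitute {m : ℕ} (p : Assertion L Var) (x : Fin m ↪ Var)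
    (t : Fin m → L.Term Var) : Assertion L Var :=
  BoundedFormula.subst p (substMap x t)

/-- The assertion `∃ x₁, …, xₘ : p`: the variables `x` are turned into bound variables. -/
noncomputable def Assertion.existsVars {m : ℕ} (x : Fin m ↪ Var) (p : Assertion L Var) :
    Assertion L Var :=
  (show L.BoundedFormula Var m from
    BoundedFormula.relabel (Function.extend x Sum.inr Sum.inl : Var → Var ⊕ Fin m) p).exs

/-- `free(p)` -/
def Assertion.free [DecidableEq Var] (p : Assertion L Var) : Set Var :=
  ↑(BoundedFormula.freeVarFinset p)

/-- The variables occurring in a list of expressions. -/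
def termVars [DecidableEq Var] {m : ℕ} (t : Fin m → L.Term Var) : Set Var :=
  ⋃ j, ↑(t j).varFinset

/-- The variables occurring in a statement. -/
def Stmt.vars [DecidableEq Var] : Stmt L Var ar → Set Var
  | .skip => ∅
  | .assign x t => Set.range x ∪ termVars t
  | .call _ t => termVars t
  | .seq S₁ S₂ => S₁.vars ∪ S₂.vars
  | .ite B S₁ S₂ => Assertion.free B.1 ∪ S₁.vars ∪ S₂.vars
  | .while B S => Assertion.free B.1 ∪ S.vars
  | .block x t S => Set.range x ∪ termVars t ∪ S.vars

/-- `var(D | S)` -/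
def progVars [DecidableEq Var] (D : Decls L Var ar) (S : Stmt L Var ar) : Set Var :=
  (⋃ i, Set.range (D.params i) ∪ (D.body i).vars) ∪ S.vars

/-- The variables a statement can change, given the variables `c i` changed by calls of `P_i`. -/
def Stmt.changeWith (c : Fin n → Set Var) : Stmt L Var ar → Set Var
  | .skip => ∅
  | .assign x _ => Set.range x
  | .call i _ => c i
  | .seq S₁ S₂ => S₁.changeWith c ∪ S₂.changeWith c
  | .ite _ S₁ S₂ => S₁.changeWith c ∪ S₂.changeWith c
  | .while _ S => S.changeWith c
  | .block x _ S => S.changeWith c \ Set.range x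

/-- `change(D)`, the union of the sets `change(∅ | S_i)`, in which calls count for nothing. -/
def Decls.change (D : Decls L Var ar) : Set Var :=
  ⋃ i, (D.body i).changeWith (fun _ => ∅)

/-- `change(D | S)`, where `change(D | P_i(t)) = change(D) \ {u_i}`. -/
def progChange (D : Decls L Var ar) (S : Stmt L Var ar) : Set Var :=
  S.changeWith (fun i => D.change \ Set.range (D.params i))

/-- The size `l(S)` of a statement. -/
def Stmt.len : Stmt L Var ar → ℕ
  | .skip => 1
  | .assign _ _ => 1
  | .call _ _ => 1
  | .seq S₁ S₂ => S₁.len + S₂.len + 1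
  | .ite _ S₁ S₂ => S₁.len + S₂.len + 1
  | .while _ S => S.len + 1
  | .block _ _ S => (1 + S.len + 1) + 1

/-- The size `l(D | S) = l(D) + l(S)` of a program. -/
def progLen (D : Decls L Var ar) (S : Stmt L Var ar) : ℕ :=
  (∑ i, (D.body i).len) + S.len

end Programs

section Semantics

variable {L : FirstOrder.Language.{u, v}} {Var : Type w} {n : ℕ} {ar : Fin n → ℕ}

/-- `Exec M D S σ τ`: the program `(D | S)`, started in the state `σ`, terminates in `τ`. -/
inductive Exec (M : Type z) [L.Structure M] (D : Decls L Var ar) :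
    Stmt L Var ar → (Var → M) → (Var → M) → Prop where
  | skip (σ : Var → M) : Exec M D .skip σ σ
  | assign {m : ℕ} (x : Fin m ↪ Var) (t : Fin m → L.Term Var) (σ : Var → M) :
      Exec M D (.assign x t) σ (Function.extend x (fun j => (t j).realize σ) σ)
  | seq {S₁ S₂ : Stmt L Var ar} {σ ρ τ : Var → M} :
      Exec M D S₁ σ ρ → Exec M D S₂ ρ τ → Exec M D (.seq S₁ S₂) σ τ
  | iteTrue {B : BoolExpr L Var} {S₁ S₂ : Stmt L Var ar} {σ τ : Var → M} :
      B.1.Realize σ → Exec M D S₁ σ τ → Exec M D (.ite B S₁ S₂) σ τ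
  | iteFalse {B : BoolExpr L Var} {S₁ S₂ : Stmt L Var ar} {σ τ : Var → M} :
      ¬ B.1.Realize σ → Exec M D S₂ σ τ → Exec M D (.ite B S₁ S₂) σ τ
  | whileFalse {B : BoolExpr L Var} {S : Stmt L Var ar} {σ : Var → M} :
      ¬ B.1.Realize σ → Exec M D (.while B S) σ σ
  | whileTrue {B : BoolExpr L Var} {S : Stmt L Var ar} {σ ρ τ : Var → M} :
      B.1.Realize σ → Exec M D S σ ρ → Exec M D (.while B S) ρ τ → Exec M D (.while B S) σ τ
  /-- on leaving a block, its local variables get back the values they had before the block -/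
  | block {m : ℕ} {x : Fin m ↪ Var} {t : Fin m → L.Term Var} {S : Stmt L Var ar}
      {σ τ : Var → M} : Exec M D (.seq (.assign x t) S) σ τ →
      Exec M D (.block x t S) σ (Function.extend x (fun j => σ (x j)) τ)
  /-- call-by-value through inlining -/
  | call {i : Fin n} {t : Fin (ar i) → L.Term Var} {σ τ : Var → M} :
      Exec M D (.block (D.params i) t (D.body i)) σ τ → Exec M D (.call i t) σ τ

/-- The meaning of an assertion: the set of states in which it is true. -/
def meaning (M : Type z) [L.Structure M] (p : Assertion L Var) : Set (Var → M) :=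
  {σ | p.Realize σ}

/-- The assertion `p` is true in the interpretation `M`. -/
def TrueIn (M : Type z) [L.Structure M] (p : Assertion L Var) : Prop :=
  meaning M p = Set.univ

/-- The strongest postcondition `sp(p, S)`: all states that `(D | S)` can reach from a state
satisfying `p`. -/
def sp (M : Type z) [L.Structure M] (D : Decls L Var ar) (p : Assertion L Var)
    (S : Stmt L Var ar) : Set (Var → M) :=
  {τ | ∃ σ ∈ meaning M p, Exec M D S σ τ}

/-- `{p} S {q}` is true in `M` in the sense of partial correctness. -/
def Valid (M : Type z) [L.Structure M] (D : Decls L Var ar) (p : Assertion L Var)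
    (S : Stmt L Var ar) (q : Assertion L Var) : Prop :=
  sp M D p S ⊆ meaning M q

end Semantics

/-- `L` is expressive relative to `M`: for all assertions `p` and programs `(D | S)`, the strongest
postcondition is defined by a formula of `L`. -/
def Expressive (L : FirstOrder.Language.{u, v}) (Var : Type w) (M : Type z) [L.Structure M] : Prop :=
  ∀ (n : ℕ) (ar : Fin n → ℕ) (D : Decls L Var ar) (p : Assertion L Var) (S : Stmt L Var ar),
    ∃ φ : Assertion L Var, sp M D p S = meaning M φ

/-- The correctness formula `{pre} stmt {post}`. -/
structure CorrectnessFormula (L : FirstOrder.Language.{u, v}) (Var : Type w) {n : ℕ} (ar : Fin n → ℕ) :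
    Type (max u v w) where
  pre : Assertion L Var
  stmt : Stmt L Var ar
  post : Assertion L Var

/-- `cbv` is the full proof system; `core` is the system without the RECURSION rule. -/
inductive System : Type where
  | core
  | cbv

/-- Proofs (as trees), in the given system, of a correctness formula from a set `Φ` of correctness
formulas and all assertions true in `M`. -/
inductive Derivation {L : FirstOrder.Language.{u, v}} {Var : Type w} [DecidableEq Var] {n : ℕ}
    {ar : Fin n → ℕ} (M : Type z) [L.Structure M] (D : Decls L Var ar) :
    System → Set (CorrectnessFormula L Var ar) → CorrectnessFormula L Var ar →
      Type (max u v w) where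
  | assumption {s Φ} {f : CorrectnessFormula L Var ar} (hf : f ∈ Φ) : Derivation M D s Φ f
  | skip {s Φ} (p : Assertion L Var) : Derivation M D s Φ ⟨p, .skip, p⟩
  | assign {s Φ} {m : ℕ} (x : Fin m ↪ Var) (t : Fin m → L.Term Var) (p : Assertion L Var) :
      Derivation M D s Φ ⟨p.substitute x t, .assign x t, p⟩
  | composition {s Φ} {p r q : Assertion L Var} {S₁ S₂ : Stmt L Var ar} :
      Derivation M D s Φ ⟨p, S₁, r⟩ → Derivation M D s Φ ⟨r, S₂, q⟩ →
      Derivation M D s Φ ⟨p, .seq S₁ S₂, q⟩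
  | conditional {s Φ} {p q : Assertion L Var} {B : BoolExpr L Var} {S₁ S₂ : Stmt L Var ar} :
      Derivation M D s Φ ⟨p ⊓ B.1, S₁, q⟩ → Derivation M D s Φ ⟨p ⊓ B.1.not, S₂, q⟩ →
      Derivation M D s Φ ⟨p, .ite B S₁ S₂, q⟩
  | while {s Φ} {p : Assertion L Var} {B : BoolExpr L Var} {S : Stmt L Var ar} :
      Derivation M D s Φ ⟨p ⊓ B.1, S, p⟩ → Derivation M D s Φ ⟨p, .while B S, p ⊓ B.1.not⟩
  | block {s Φ} {p q : Assertion L Var} {m : ℕ} {x : Fin m ↪ Var} {t : Fin m → L.Term Var}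
      {S : Stmt L Var ar} (hq : Disjoint (Set.range x) q.free) :
      Derivation M D s Φ ⟨p, .seq (.assign x t) S, q⟩ → Derivation M D s Φ ⟨p, .block x t S, q⟩
  | procedureCall {s Φ} {p q : Assertion L Var} {i : Fin n} (t : Fin (ar i) → L.Term Var)
      (hq : Disjoint (Set.range (D.params i)) q.free) :
      Derivation M D s Φ ⟨p, D.genericCall i, q⟩ →
      Derivation M D s Φ ⟨p.substitute (D.params i) t, .call i t, q⟩
  | substitution {s Φ} {p q : Assertion L Var} {S : Stmt L Var ar} {m : ℕ} (x : Fin m ↪ Var)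
      (y : Fin m → Var) (hx : Disjoint (Set.range x) (progVars D S))
      (hy : Disjoint (Set.range y) (progChange D S)) :
      Derivation M D s Φ ⟨p, S, q⟩ →
      Derivation M D s Φ
        ⟨p.substitute x (fun j => Term.var (y j)), S, q.substitute x (fun j => Term.var (y j))⟩
  | invariance {s Φ} {r q : Assertion L Var} {S : Stmt L Var ar} (p : Assertion L Var)
      (hp : Disjoint p.free (progChange D S)) :
      Derivation M D s Φ ⟨r, S, q⟩ → Derivation M D s Φ ⟨p ⊓ r, S, p ⊓ q⟩
  | existsIntro {s Φ} {p q : Assertion L Var} {S : Stmt L Var ar} {m : ℕ} (x : Fin m ↪ Var)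
      (hx : Disjoint (Set.range x) (progVars D S ∪ q.free)) :
      Derivation M D s Φ ⟨p, S, q⟩ → Derivation M D s Φ ⟨p.existsVars x, S, q⟩
  | consequence {s Φ} {p p₁ q₁ q : Assertion L Var} {S : Stmt L Var ar}
      (hp : TrueIn M (p.imp p₁)) (hq : TrueIn M (q₁.imp q)) :
      Derivation M D s Φ ⟨p₁, S, q₁⟩ → Derivation M D s Φ ⟨p, S, q⟩
  /-- From the assumptions `{p_i} P_i(u_i) {q_i}`, one for each declared procedure, derive, without
  using RECURSION, both `{p} S {q}` and all `{p_i} S_i {q_i}`. -/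
  | recursion {Φ} {p q : Assertion L Var} {S : Stmt L Var ar} (pre post : Fin n → Assertion L Var)
      (hpost : ∀ i, Disjoint (Set.range (D.params i)) (post i).free) :
      Derivation M D .core (Set.range fun i => ⟨pre i, D.genericCall i, post i⟩) ⟨p, S, q⟩ →
      (∀ i, Derivation M D .core (Set.range fun i => ⟨pre i, D.genericCall i, post i⟩)
        ⟨pre i, D.body i, post i⟩) →
      Derivation M D .cbv Φ ⟨p, S, q⟩

/-- The number of applications of axioms and proof rules in a proof, subsidiary proofs included. -/
def Derivation.size {L : FirstOrder.Language.{u, v}} {Var : Type w} [DecidableEq Var] {n : ℕ}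
    {ar : Fin n → ℕ} {M : Type z} [L.Structure M] {D : Decls L Var ar} {s : System}
    {Φ : Set (CorrectnessFormula L Var ar)} {f : CorrectnessFormula L Var ar} :
    Derivation M D s Φ f → ℕ
  | .assumption _ => 0
  | .skip _ => 1
  | .assign _ _ _ => 1
  | .composition d₁ d₂ => d₁.size + d₂.size + 1
  | .conditional d₁ d₂ => d₁.size + d₂.size + 1
  | .while d => d.size + 1
  | .block _ d => d.size + 1
  | .procedureCall _ _ d => d.size + 1
  | .substitution _ _ _ _ d => d.size + 1
  | .invariance _ _ d => d.size + 1
  | .existsIntro _ _ d => d.size + 1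
  | .consequence _ _ d => d.size + 1
  | .recursion _ _ _ d e => d.size + (∑ i, (e i).size) + 1

/-- `Φ ⊢ᵏ {p} S {q}`: there is a proof in the full system from `Φ` and all assertions true in `M`
that consists of at most `k` applications of axioms and proof rules. -/
def ProvableIn {L : FirstOrder.Language.{u, v}} {Var : Type w} [DecidableEq Var] {n : ℕ}
    {ar : Fin n → ℕ} (M : Type z) [L.Structure M] (D : Decls L Var ar)
    (Φ : Set (CorrectnessFormula L Var ar)) (k : ℕ) (f : CorrectnessFormula L Var ar) : Prop :=
  ∃ d : Derivation M D .cbv Φ f, d.size ≤ k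

end CBV

/-!
Let `x` list the variables of `D` and let `z` be fresh. By expressiveness there are assertions `G_i`
such that `{x = z} P_i(u_i) {G_i}` describes all computations of `P_i`, the variables `z` standing
for the initial values of `x`. RECURSION has to be applied only once, with these most general
formulas as assumptions, since they are true of the bodies. Every true formula `{p} P_i(t) {q}`
follows from the `i`-th assumption by a bounded number of rules, none of which has to look into the
body: rename `z` to fresh variables `z'`, instantiate the parameters, add by INVARIANCE the fact
that `p` held of the values now recorded in `z'`, and quantify over `z'`.

The other constructs add a bounded number of steps each, their intermediate assertions being defined
by strongest postconditions. The invariant of `while B do S od` is the set of states reached after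
some number of iterations: up to the values of fresh variables `z`, these are the final states of
the loop with guard `B ∧ ¬ x = z`, where `x` now lists all variables of the loop: it may stop in any
state whose values have been guessed in `z`.
-/

namespace CBV

open FirstOrder.Language

section Updates

variable {ι α β : Type*}

theorem eqOn_extend_of_disjoint {x : ι → α} {W : Set α} (h : Disjoint (Set.range x) W)
    (d : ι → β) (σ : α → β) : Set.EqOn (Function.extend x d σ) σ W :=
  fun _ ha => Function.extend_apply' _ _ _ (Set.disjoint_right.1 h ha)

theorem eqOn_extend {σ τ : α → β} {W : Set α} (h : Set.EqOn σ τ W) (x : ι → α) (d : ι → β) :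
    Set.EqOn (Function.extend x d σ) (Function.extend x d τ) W := by
  intro a ha
  unfold Function.extend
  rw [h ha]

theorem extend_comp_eq {x : ι → α} {σ τ : α → β} (h : Set.EqOn σ τ (Set.range x)ᶜ) :
    Function.extend x (fun j => τ (x j)) σ = τ := by
  funext a
  unfold Function.extend
  split_ifs with ha
  · exact congrArg τ ha.choose_spec
  · exact h ha

theorem exists_embedding_disjoint_range [Infinite α] (m : ℕ) {F : Set α} (hF : F.Finite) :
    ∃ y : Fin m ↪ α, Disjoint (Set.range y) F := by
  let e := hF.infinite_compl.natEmbedding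
  refine ⟨(Fin.valEmbedding.trans e).trans (.subtype _), Set.disjoint_left.2 ?_⟩
  rintro _ ⟨j, rfl⟩
  exact (e j).2

end Updates

section FreeVariables

variable {L : FirstOrder.Language.{u, v}} {α β γ δ : Type*}

theorem relabel_eq_subst (t : L.Term γ) (g : γ → δ) :
    t.relabel g = t.subst fun c => Term.var (g c) := by
  induction t with
  | var => rfl
  | func f ts ih => simp only [Term.relabel, Term.subst, ih]

theorem varFinsetLeft_relabel_inl [DecidableEq α] (t : L.Term α) :
    (t.relabel (Sum.inl : α → α ⊕ γ)).varFinsetLeft = t.varFinset := by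
  induction t with
  | var => rfl
  | func f ts ih => simp only [Term.relabel, Term.varFinsetLeft, Term.varFinset, ih]

theorem exists_mem_varFinsetLeft_of_mem_subst [DecidableEq α] [DecidableEq β]
    {f : α ⊕ γ → L.Term (β ⊕ δ)} {b : β} (hf : ∀ c, b ∉ (f (Sum.inr c)).varFinsetLeft)
    {t : L.Term (α ⊕ γ)} (hb : b ∈ (t.subst f).varFinsetLeft) :
    ∃ a ∈ t.varFinsetLeft, b ∈ (f (Sum.inl a)).varFinsetLeft := by
  induction t with
  | var c =>
    rcases c with a | c
    · exact ⟨a, Finset.mem_singleton_self a, hb⟩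
    · exact (hf c hb).elim
  | func g ts ih =>
    simp only [Term.subst, Term.varFinsetLeft, Finset.mem_biUnion, Finset.mem_univ,
      true_and] at hb ⊢
    obtain ⟨i, hi⟩ := hb
    obtain ⟨a, ha, hb⟩ := ih i hi
    exact ⟨a, ⟨i, ha⟩, hb⟩

theorem exists_mem_freeVarFinset_of_mem_mapTermRel [DecidableEq α] [DecidableEq β] {g : ℕ → ℕ}
    {ft : ∀ n, L.Term (α ⊕ Fin n) → L.Term (β ⊕ Fin (g n))}
    {fr : ∀ n, L.Relations n → L.Relations n}
    {h : ∀ n, L.BoundedFormula β (g (n + 1)) → L.BoundedFormula β (g n + 1)}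
    (hh : ∀ n ψ, (h n ψ).freeVarFinset = ψ.freeVarFinset) {b : β} {Q : α → Prop}
    (hft : ∀ n t, b ∈ (ft n t).varFinsetLeft → ∃ a ∈ t.varFinsetLeft, Q a)
    {k : ℕ} {φ : L.BoundedFormula α k} (hb : b ∈ (φ.mapTermRel ft fr h).freeVarFinset) :
    ∃ a ∈ φ.freeVarFinset, Q a := by
  induction φ with
  | falsum => simp [BoundedFormula.mapTermRel] at hb
  | equal t₁ t₂ =>
    simp only [BoundedFormula.mapTermRel, BoundedFormula.freeVarFinset, Finset.mem_union] at hb ⊢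
    grind
  | rel R ts =>
    simp only [BoundedFormula.mapTermRel, BoundedFormula.freeVarFinset, Finset.mem_biUnion,
      Finset.mem_univ, true_and] at hb ⊢
    grind
  | imp φ ψ ihφ ihψ =>
    simp only [BoundedFormula.mapTermRel, BoundedFormula.freeVarFinset, Finset.mem_union] at hb ⊢
    grind
  | all φ ih =>
    simp only [BoundedFormula.mapTermRel, BoundedFormula.freeVarFinset, hh] at hb
    exact ih hb

theorem exists_mem_freeVarFinset_of_mem_subst [DecidableEq α] [DecidableEq β] {k : ℕ}
    {φ : L.BoundedFormula α k} {f : α → L.Term β} {b : β} (hb : b ∈ (φ.subst f).freeVarFinset) :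
    ∃ a ∈ φ.freeVarFinset, b ∈ (f a).varFinset := by
  refine exists_mem_freeVarFinset_of_mem_mapTermRel (g := id) (h := fun _ => id)
    (fun _ _ => rfl) (fun n t ht => ?_) hb
  obtain ⟨a, ha, hb⟩ :=
    exists_mem_varFinsetLeft_of_mem_subst (fun _ => Finset.notMem_empty b) ht
  exact ⟨a, ha, varFinsetLeft_relabel_inl (f a) ▸ hb⟩

theorem exists_mem_freeVarFinset_of_mem_relabel [DecidableEq α] [DecidableEq β] {k m : ℕ}
    {φ : L.BoundedFormula α k} {g : α → β ⊕ Fin m} {b : β}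
    (hb : b ∈ (φ.relabel g).freeVarFinset) : ∃ a ∈ φ.freeVarFinset, g a = Sum.inl b := by
  refine exists_mem_freeVarFinset_of_mem_mapTermRel (g := (m + ·))
    (fun _ ψ => congrArg BoundedFormula.freeVarFinset (BoundedFormula.castLE_rfl _ ψ))
    (fun n t ht => ?_) hb
  rw [relabel_eq_subst] at ht
  obtain ⟨a, ha, hb⟩ :=
    exists_mem_varFinsetLeft_of_mem_subst (fun _ => Finset.notMem_empty b) ht
  refine ⟨a, ha, ?_⟩
  rcases hga : g a with b' | j
  · simp_all [BoundedFormula.relabelAux]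
  · simp [BoundedFormula.relabelAux, hga] at hb

theorem freeVarFinset_exs [DecidableEq α] {k : ℕ} (φ : L.BoundedFormula α k) :
    BoundedFormula.freeVarFinset φ.exs = φ.freeVarFinset := by
  induction k with
  | zero => rfl
  | succ k ih =>
    rw [BoundedFormula.exs, ih]
    exact Finset.union_empty _ |>.trans (Finset.union_empty _)

theorem term_realize_congr [DecidableEq α] {M : Type*} [L.Structure M] {t : L.Term α}
    {σ τ : α → M} (h : Set.EqOn σ τ t.varFinset) : t.realize σ = t.realize τ := by
  rw [← Term.realize_restrictVar' (s := t.varFinset) (v := σ) subset_rfl,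
    ← Term.realize_restrictVar' (s := t.varFinset) (v := τ) subset_rfl]
  exact congrArg (fun v => Term.realize v _) (Set.domRestrict_eq_domRestrict_iff.2 h)

theorem formula_realize_congr [DecidableEq α] {M : Type*} [L.Structure M] {p : L.Formula α}
    {σ τ : α → M} (h : Set.EqOn σ τ (BoundedFormula.freeVarFinset p)) :
    p.Realize σ ↔ p.Realize τ := by
  unfold Formula.Realize
  rw [← BoundedFormula.realize_restrictFreeVar' (s := BoundedFormula.freeVarFinset p) (v := σ)
      subset_rfl,
    ← BoundedFormula.realize_restrictFreeVar' (s := BoundedFormula.freeVarFinset p) (v := τ)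
      subset_rfl]
  exact iff_of_eq (congrArg₂ _ (Set.domRestrict_eq_domRestrict_iff.2 h) rfl)

end FreeVariables

section Assertions

variable {L : FirstOrder.Language.{u, v}} {Var : Type w} {M : Type z} [L.Structure M] {m : ℕ}

theorem realize_substitute (p : Assertion L Var) (x : Fin m ↪ Var) (t : Fin m → L.Term Var)
    (σ : Var → M) :
    (p.substitute x t).Realize σ ↔ p.Realize (Function.extend x (fun j => (t j).realize σ) σ) := by
  have hsubst : (fun a => (substMap x t a).realize σ) =
      Function.extend x (fun j => (t j).realize σ) σ := by
    funext a
    unfold substMap Function.extend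
    split_ifs <;> rfl
  unfold Formula.Realize Assertion.substitute
  rw [BoundedFormula.realize_subst, hsubst]

theorem realize_existsVars (p : Assertion L Var) (x : Fin m ↪ Var) (σ : Var → M) :
    (p.existsVars x).Realize σ ↔ ∃ d : Fin m → M, p.Realize (Function.extend x d σ) := by
  unfold Assertion.existsVars
  rw [BoundedFormula.realize_exs]
  refine exists_congr fun d => ?_
  have hrelabel : Sum.elim σ (d ∘ Fin.castAdd 0) ∘ Function.extend x Sum.inr Sum.inl =
      Function.extend x d σ := by
    funext a
    simp only [Function.comp_apply, Function.extend]
    split_ifs <;> rfl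
  erw [BoundedFormula.realize_relabel, hrelabel]
  exact iff_of_eq (congrArg _ (Subsingleton.elim _ _))

/-- The assertion `x₁ = y₁ ∧ … ∧ xₘ = yₘ`, by which the variables `y` record the values of `x`. -/
def eqVars : {m : ℕ} → (Fin m → Var) → (Fin m → Var) → Assertion L Var
  | 0, _, _ => ⊤
  | _ + 1, x, y => Term.equal (Term.var (x 0)) (Term.var (y 0)) ⊓
      eqVars (fun j => x j.succ) fun j => y j.succ

theorem realize_eqVars (x y : Fin m → Var) (σ : Var → M) :
    (eqVars (L := L) x y).Realize σ ↔ ∀ j, σ (x j) = σ (y j) := by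
  induction m with
  | zero => simp [eqVars]
  | succ m ih => simp [eqVars, ih, Fin.forall_fin_succ]

theorem isQF_eqVars (x y : Fin m → Var) : (eqVars (L := L) x y).IsQF := by
  induction m with
  | zero => exact BoundedFormula.IsQF.top
  | succ m ih => exact (BoundedFormula.IsAtomic.equal _ _).isQF.inf (ih _ _)

theorem trueIn_imp {p q : Assertion L Var} :
    TrueIn M (p.imp q) ↔ ∀ σ : Var → M, p.Realize σ → q.Realize σ := by
  simp [TrueIn, meaning, Set.eq_univ_iff_forall]

variable [DecidableEq Var]

theorem realize_extend_of_disjoint {p : Assertion L Var} {x : Fin m ↪ Var}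
    (h : Disjoint (Set.range x) p.free) (d : Fin m → M) (σ : Var → M) :
    p.Realize (Function.extend x d σ) ↔ p.Realize σ :=
  formula_realize_congr (eqOn_extend_of_disjoint h d σ)

theorem free_substitute_var_subset (p : Assertion L Var) (x : Fin m ↪ Var) (y : Fin m → Var) :
    (p.substitute x fun j => Term.var (y j)).free ⊆ p.free \ Set.range x ∪ Set.range y := by
  intro b hb
  obtain ⟨a, ha, hab⟩ := exists_mem_freeVarFinset_of_mem_subst hb
  by_cases hax : a ∈ Set.range x
  · obtain ⟨j, rfl⟩ := hax
    rw [substMap, x.injective.extend_apply] at hab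
    exact .inr ⟨j, (Finset.mem_singleton.1 hab).symm⟩
  · rw [substMap, Function.extend_apply' _ _ _ hax] at hab
    rw [Finset.mem_singleton.1 hab]
    exact .inl ⟨ha, hax⟩

theorem disjoint_free_existsVars (p : Assertion L Var) (x : Fin m ↪ Var) :
    Disjoint (Set.range x) (p.existsVars x).free := by
  refine Set.disjoint_right.2 fun b hb => ?_
  unfold Assertion.free Assertion.existsVars at hb
  rw [freeVarFinset_exs] at hb
  obtain ⟨a, -, hab⟩ := exists_mem_freeVarFinset_of_mem_relabel hb
  unfold Function.extend at hab
  split_ifs at hab with ha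
  rwa [← Sum.inl_injective hab]

theorem free_inf (p q : Assertion L Var) : Assertion.free (p ⊓ q) = p.free ∪ q.free := by
  simp [Assertion.free, Min.min, BoundedFormula.not, Bot.bot]

theorem free_eqVars_subset (x y : Fin m → Var) :
    (eqVars (L := L) x y).free ⊆ Set.range x ∪ Set.range y := by
  induction m with
  | zero => simp [eqVars, Assertion.free, Top.top, BoundedFormula.not, Bot.bot]
  | succ m ih =>
    rw [eqVars, free_inf]
    refine Set.union_subset ?_ ((ih _ _).trans ?_)
    · intro a ha
      have ha' : a = x 0 ∨ a = y 0 := by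
        simpa [Assertion.free, Term.equal, Term.bdEqual] using ha
      rcases ha' with rfl | rfl
      · exact .inl ⟨0, rfl⟩
      · exact .inr ⟨0, rfl⟩
    · exact Set.union_subset_union (Set.range_comp_subset_range Fin.succ x)
        (Set.range_comp_subset_range Fin.succ y)

theorem finite_free (p : Assertion L Var) : p.free.Finite :=
  Finset.finite_toSet _

end Assertions

section Programs

variable {L : FirstOrder.Language.{u, v}} {Var : Type w} {n : ℕ} {ar : Fin n → ℕ}

theorem Stmt.one_le_len (S : Stmt L Var ar) : 1 ≤ S.len := by
  cases S <;> simp [Stmt.len]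

theorem Stmt.changeWith_subset {c : Fin n → Set Var} {E : Set Var} (h : ∀ i, c i ⊆ E) :
    ∀ S : Stmt L Var ar, S.changeWith c ⊆ S.changeWith (fun _ => ∅) ∪ E
  | .skip => Set.empty_subset _
  | .assign _ _ => Set.subset_union_left
  | .call i _ => (h i).trans Set.subset_union_right
  | .seq S₁ S₂ | .ite _ S₁ S₂ => by
    rw [changeWith, changeWith, Set.union_union_distrib_right]
    exact Set.union_subset_union (S₁.changeWith_subset h) (S₂.changeWith_subset h)
  | .while _ S => S.changeWith_subset h
  | .block _ _ S => fun _ ha => (S.changeWith_subset h ha.1).imp_left fun h => ⟨h, ha.2⟩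

theorem Decls.changeWith_body_subset (D : Decls L Var ar) (i : Fin n) :
    (D.body i).changeWith (fun j => D.change \ Set.range (D.params j)) ⊆ D.change :=
  ((D.body i).changeWith_subset fun _ => Set.sdiff_subset).trans <|
    Set.union_subset (Set.subset_iUnion (fun i => (D.body i).changeWith fun _ => ∅) i) subset_rfl

variable [DecidableEq Var]

/-- The variables occurring in a set of procedure declarations, so that `var(D | S)` is the union of
`D.vars` and `S.vars`. -/
def Decls.vars (D : Decls L Var ar) : Set Var :=
  ⋃ i, Set.range (D.params i) ∪ (D.body i).vars

theorem Decls.params_subset_vars (D : Decls L Var ar) (i : Fin n) :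
    Set.range (D.params i) ⊆ D.vars :=
  fun _ ha => Set.mem_iUnion.2 ⟨i, .inl ha⟩

theorem Decls.body_subset_vars (D : Decls L Var ar) (i : Fin n) : (D.body i).vars ⊆ D.vars :=
  fun _ ha => Set.mem_iUnion.2 ⟨i, .inr ha⟩

theorem Stmt.changeWith_subset_vars_union {c : Fin n → Set Var} {E : Set Var}
    (h : ∀ i, c i ⊆ E) : ∀ S : Stmt L Var ar, S.changeWith c ⊆ S.vars ∪ E
  | .skip => Set.empty_subset _
  | .assign _ _ => Set.subset_union_left.trans Set.subset_union_left
  | .call i _ => (h i).trans Set.subset_union_right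
  | .seq S₁ S₂ => by
    rw [changeWith, vars, Set.union_union_distrib_right]
    exact Set.union_subset_union (S₁.changeWith_subset_vars_union h)
      (S₂.changeWith_subset_vars_union h)
  | .ite _ S₁ S₂ => by
    rw [changeWith, vars, Set.union_assoc _ S₁.vars, Set.union_assoc, Set.union_union_distrib_right]
    exact (Set.union_subset_union (S₁.changeWith_subset_vars_union h)
      (S₂.changeWith_subset_vars_union h)).trans Set.subset_union_right
  | .while _ S => fun _ ha => (S.changeWith_subset_vars_union h ha).imp_left .inr
  | .block _ _ S => fun _ ha => (S.changeWith_subset_vars_union h ha.1).imp_left .inr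

theorem Decls.change_subset_vars (D : Decls L Var ar) : D.change ⊆ D.vars := by
  refine Set.iUnion_subset fun i => ?_
  have h := (D.body i).changeWith_subset_vars_union (c := fun _ => ∅) (fun _ => subset_rfl)
  rw [Set.union_empty] at h
  exact h.trans (D.body_subset_vars i)

theorem progChange_subset_progVars (D : Decls L Var ar) (S : Stmt L Var ar) :
    progChange D S ⊆ progVars D S :=
  (S.changeWith_subset_vars_union fun _ => Set.sdiff_subset.trans D.change_subset_vars).trans
    (Set.union_comm _ _).subset

theorem finite_termVars {m : ℕ} (t : Fin m → L.Term Var) : (termVars t).Finite :=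
  Set.finite_iUnion fun _ => Finset.finite_toSet _

theorem Stmt.finite_vars : ∀ S : Stmt L Var ar, S.vars.Finite
  | .skip => Set.finite_empty
  | .assign _ t => (Set.finite_range _).union (finite_termVars t)
  | .call _ t => finite_termVars t
  | .seq S₁ S₂ => S₁.finite_vars.union S₂.finite_vars
  | .ite B S₁ S₂ => ((finite_free B.1).union S₁.finite_vars).union S₂.finite_vars
  | .while B S => (finite_free B.1).union S.finite_vars
  | .block _ t S => ((Set.finite_range _).union (finite_termVars t)).union S.finite_vars

theorem Decls.finite_vars (D : Decls L Var ar) : D.vars.Finite :=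
  Set.finite_iUnion fun i => (Set.finite_range _).union (D.body i).finite_vars

theorem finite_progVars (D : Decls L Var ar) (S : Stmt L Var ar) : (progVars D S).Finite :=
  D.finite_vars.union S.finite_vars

end Programs

section Execution

variable {L : FirstOrder.Language.{u, v}} {Var : Type w} {n : ℕ} {ar : Fin n → ℕ} {M : Type z}
  [L.Structure M] {D : Decls L Var ar}

theorem valid_iff {p q : Assertion L Var} {S : Stmt L Var ar} :
    Valid M D p S q ↔ ∀ σ τ, p.Realize σ → Exec M D S σ τ → q.Realize τ :=
  ⟨fun h σ _ hσ e => h ⟨σ, hσ, e⟩, fun h τ ⟨σ, hσ, e⟩ => h σ τ hσ e⟩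

theorem Expressive.exists_realize_iff (hexp : Expressive L Var M) (D : Decls L Var ar)
    (p : Assertion L Var) (S : Stmt L Var ar) :
    ∃ φ : Assertion L Var, ∀ τ : Var → M, φ.Realize τ ↔ ∃ σ, p.Realize σ ∧ Exec M D S σ τ := by
  obtain ⟨φ, hφ⟩ := hexp n ar D p S
  exact ⟨φ, fun τ => (Set.ext_iff.1 hφ τ).symm⟩

theorem Exec.eqOn_compl_progChange {S : Stmt L Var ar} {σ τ : Var → M} (h : Exec M D S σ τ) :
    Set.EqOn σ τ (progChange D S)ᶜ := by
  intro a ha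
  unfold progChange at ha
  induction h with
  | skip => rfl
  | assign => exact (Function.extend_apply' _ _ _ ha).symm
  | seq _ _ ih₁ ih₂ => exact (ih₁ fun h => ha (.inl h)).trans (ih₂ fun h => ha (.inr h))
  | iteTrue _ _ ih => exact ih fun h => ha (.inl h)
  | iteFalse _ _ ih => exact ih fun h => ha (.inr h)
  | whileFalse => rfl
  | whileTrue _ _ _ ih₁ ih₂ => exact (ih₁ ha).trans (ih₂ ha)
  | @block _ x _ _ _ _ _ ih =>
    by_cases hx : a ∈ Set.range x
    · obtain ⟨j, rfl⟩ := hx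
      rw [x.injective.extend_apply]
    · rw [Function.extend_apply' _ _ _ hx]
      exact ih fun h => h.elim hx fun h => ha ⟨h, hx⟩
  | call _ ih => exact ih fun h => ha ⟨D.changeWith_body_subset _ h.1, h.2⟩

variable [DecidableEq Var]

theorem realize_terms_congr {m : ℕ} {t : Fin m → L.Term Var} {σ τ : Var → M}
    (h : Set.EqOn σ τ (termVars t)) : (fun j => (t j).realize σ) = fun j => (t j).realize τ :=
  funext fun j => term_realize_congr
    (h.mono (Set.subset_iUnion (fun j => ((t j).varFinset : Set Var)) j))

theorem Exec.exists_eqOn {W : Set Var} (hD : D.vars ⊆ W) {S : Stmt L Var ar} {σ τ : Var → M}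
    (h : Exec M D S σ τ) (hS : S.vars ⊆ W) {σ' : Var → M} (hσ : Set.EqOn σ σ' W) :
    ∃ τ', Exec M D S σ' τ' ∧ Set.EqOn τ τ' W := by
  induction h generalizing σ' with
  | skip => exact ⟨_, .skip _, hσ⟩
  | assign x t σ =>
    refine ⟨_, .assign x t σ', ?_⟩
    rw [realize_terms_congr (hσ.mono (Set.subset_union_right.trans hS))]
    exact eqOn_extend hσ _ _
  | seq _ _ ih₁ ih₂ =>
    obtain ⟨ρ, h₁, hρ⟩ := ih₁ (Set.subset_union_left.trans hS) hσ
    obtain ⟨τ, h₂, hτ⟩ := ih₂ (Set.subset_union_right.trans hS) hρ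
    exact ⟨τ, h₁.seq h₂, hτ⟩
  | iteTrue hB _ ih =>
    simp only [Stmt.vars, Set.union_subset_iff] at hS
    obtain ⟨τ, h, hτ⟩ := ih hS.1.2 hσ
    exact ⟨τ, .iteTrue ((formula_realize_congr (hσ.mono hS.1.1)).1 hB) h, hτ⟩
  | iteFalse hB _ ih =>
    simp only [Stmt.vars, Set.union_subset_iff] at hS
    obtain ⟨τ, h, hτ⟩ := ih hS.2 hσ
    exact ⟨τ, .iteFalse (hB ∘ (formula_realize_congr (hσ.mono hS.1.1)).2) h, hτ⟩
  | whileFalse hB =>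
    have hB' := formula_realize_congr (hσ.mono (Set.subset_union_left.trans hS))
    exact ⟨_, .whileFalse (hB ∘ hB'.2), hσ⟩
  | whileTrue hB _ _ ih₁ ih₂ =>
    have hB' := formula_realize_congr (hσ.mono (Set.subset_union_left.trans hS))
    obtain ⟨ρ, h₁, hρ⟩ := ih₁ (Set.subset_union_right.trans hS) hσ
    obtain ⟨τ, h₂, hτ⟩ := ih₂ hS hρ
    exact ⟨τ, .whileTrue (hB'.1 hB) h₁ h₂, hτ⟩
  | @block _ x _ _ σ _ _ ih =>
    obtain ⟨τ', h, hτ⟩ := ih hS hσ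
    refine ⟨_, .block h, ?_⟩
    have hx : (fun j => σ (x j)) = fun j => σ' (x j) :=
      funext fun j => hσ (hS (.inl (.inl ⟨j, rfl⟩)))
    rw [hx]
    exact eqOn_extend hτ _ _
  | @call i t _ _ _ ih =>
    have hblock : (Stmt.block (D.params i) t (D.body i)).vars ⊆ W :=
      Set.union_subset (Set.union_subset ((D.params_subset_vars i).trans hD) hS)
        ((D.body_subset_vars i).trans hD)
    obtain ⟨τ, h, hτ⟩ := ih hblock hσ
    exact ⟨τ, h.call, hτ⟩

theorem Exec.extend {S : Stmt L Var ar} {σ τ : Var → M} (h : Exec M D S σ τ) {m : ℕ}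
    {z : Fin m ↪ Var} (hz : Disjoint (Set.range z) (progVars D S)) (d : Fin m → M) :
    Exec M D S (Function.extend z d σ) (Function.extend z d τ) := by
  obtain ⟨τ', h', hτ'⟩ := h.exists_eqOn (W := progVars D S) Set.subset_union_left
    Set.subset_union_right (eqOn_extend_of_disjoint hz d σ).symm
  suffices Function.extend z d τ = τ' by rwa [this]
  funext a
  by_cases ha : a ∈ progVars D S
  · rw [eqOn_extend_of_disjoint hz d τ ha, hτ' ha]
  · have hac : a ∉ progChange D S := fun hac => ha (progChange_subset_progVars D S hac)
    rw [← h'.eqOn_compl_progChange hac]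
    exact eqOn_extend (W := {a}) (by simpa using (h.eqOn_compl_progChange hac).symm) z d rfl

theorem exec_call_of_body {i : Fin n} {t : Fin (ar i) → L.Term Var} {σ τ ρ ρ' : Var → M}
    (h : Exec M D (D.body i) ρ ρ')
    (hρ : Set.EqOn ρ (Function.extend (D.params i) (fun j => (t j).realize σ) σ) D.vars)
    (hρ' : Set.EqOn ρ' τ (D.vars \ Set.range (D.params i)))
    (hστ : Set.EqOn σ τ (progChange D (.call i t))ᶜ) : Exec M D (.call i t) σ τ := by
  obtain ⟨ρ'', h', hρ''⟩ := h.exists_eqOn subset_rfl (D.body_subset_vars i) hρ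
  have hcall := (Exec.block ((Exec.assign (D.params i) t σ).seq h')).call
  convert hcall using 1
  funext a
  by_cases ha : a ∈ progChange D (.call i t)
  · have haD : a ∈ D.vars := D.change_subset_vars ha.1
    rw [Function.extend_apply' _ _ _ ha.2, ← hρ'' haD, hρ' ⟨haD, ha.2⟩]
  · rw [← hcall.eqOn_compl_progChange ha, hστ ha]

end Execution

section Loops

variable {L : FirstOrder.Language.{u, v}} {Var : Type w} {n : ℕ} {ar : Fin n → ℕ} {M : Type z}
  [L.Structure M] {D : Decls L Var ar} {B : BoolExpr L Var} {S : Stmt L Var ar} {σ τ : Var → M}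

/-- One iteration of `while B do S od`: the guard `B` is true in `σ`, and `S` leads to `τ`. -/
def LoopStep (M : Type z) [L.Structure M] (D : Decls L Var ar) (B : BoolExpr L Var)
    (S : Stmt L Var ar) (σ τ : Var → M) : Prop :=
  B.1.Realize σ ∧ Exec M D S σ τ

theorem Exec.reflTransGen_loopStep (h : Exec M D (.while B S) σ τ) :
    Relation.ReflTransGen (LoopStep M D B S) σ τ := by
  generalize hT : Stmt.while B S = T at h
  induction h with
  | whileFalse => exact .refl
  | whileTrue hB e _ _ ih =>
    cases hT
    exact .head ⟨hB, e⟩ (ih rfl)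
  | _ => cases hT

theorem exec_while_of_reflTransGen (h : Relation.ReflTransGen (LoopStep M D B S) σ τ)
    (hB : ¬ B.1.Realize τ) : Exec M D (.while B S) σ τ := by
  induction h using Relation.ReflTransGen.head_induction_on with
  | refl => exact .whileFalse hB
  | head hstep _ ih => exact .whileTrue hstep.1 hstep.2 ih

/-- The Boolean expression `B ∧ ¬ x = z`, the guard of a loop that stops like `while B do S od`, and
also when the variables `x` have the values recorded in `z`. -/
def BoolExpr.andNe {m : ℕ} (B : BoolExpr L Var) (x z : Fin m → Var) : BoolExpr L Var :=
  ⟨B.1 ⊓ (eqVars x z).not, B.2.inf (isQF_eqVars x z).not⟩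

theorem BoolExpr.realize_andNe {m : ℕ} {x z : Fin m → Var} :
    (B.andNe x z).1.Realize σ ↔ B.1.Realize σ ∧ ¬ ∀ j, σ (x j) = σ (z j) := by
  simp only [andNe, Formula.realize_inf, Formula.realize_not, realize_eqVars]

variable [DecidableEq Var] {m : ℕ} {x z : Fin m ↪ Var}

theorem LoopStep.extend (h : LoopStep M D B S σ τ)
    (hz : Disjoint (Set.range z) (progVars D (.while B S))) (d : Fin m → M) :
    LoopStep M D B S (Function.extend z d σ) (Function.extend z d τ) :=
  ⟨(realize_extend_of_disjoint (hz.mono_right fun _ ha => .inr (.inl ha)) _ _).2 h.1,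
    h.2.extend (hz.mono_right (Set.union_subset_union_right _ Set.subset_union_right)) d⟩

theorem eqOn_compl_progVars_of_reflTransGen
    (h : Relation.ReflTransGen (LoopStep M D B S) σ τ) :
    Set.EqOn σ τ (progVars D (.while B S))ᶜ := by
  have hsub : progChange D S ⊆ progVars D (.while B S) :=
    progChange_subset_progVars D (.while B S)
  induction h with
  | refl => exact fun _ _ => rfl
  | tail _ hstep ih =>
    exact ih.trans (hstep.2.eqOn_compl_progChange.mono (Set.compl_subset_compl.2 hsub))

theorem Exec.reflTransGen_loopStep_extend
    (hz : Disjoint (Set.range z) (progVars D (.while B S))) (d : Fin m → M)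
    (h : Exec M D (.while (B.andNe x z) S) σ τ) : Relation.ReflTransGen (LoopStep M D B S)
      (Function.extend z d σ) (Function.extend z d τ) :=
  h.reflTransGen_loopStep.lift (Function.extend z d) fun _ _ hstep =>
    LoopStep.extend ⟨(BoolExpr.realize_andNe.1 hstep.1).1, hstep.2⟩ hz d

theorem exec_while_andNe_of_reflTransGen (hx : Set.range x = progVars D (.while B S))
    (hz : Disjoint (Set.range z) (progVars D (.while B S)))
    (h : Relation.ReflTransGen (LoopStep M D B S) σ τ) :
    Exec M D (.while (B.andNe x z) S) (Function.extend z (fun j => τ (x j)) σ)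
      (Function.extend z (fun j => τ (x j)) τ) := by
  have hxz (ρ : Var → M) (j : Fin m) :
      Function.extend z (fun j => τ (x j)) ρ (x j) = ρ (x j) :=
    eqOn_extend_of_disjoint hz _ ρ (hx ▸ ⟨j, rfl⟩)
  have hexit : Exec M D (.while (B.andNe x z) S) (Function.extend z (fun j => τ (x j)) τ)
      (Function.extend z (fun j => τ (x j)) τ) := by
    refine .whileFalse fun hB => (BoolExpr.realize_andNe.1 hB).2 fun j => ?_
    rw [hxz, z.injective.extend_apply]
  induction h using Relation.ReflTransGen.head_induction_on with
  | refl => exact hexit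
  | @head σ ρ hstep hsteps ih =>
    by_cases hστ : ∀ j, σ (x j) = τ (x j)
    · have heq : σ = τ := by
        rw [← Set.eqOn_univ, ← Set.union_compl_self (progVars D (.while B S)), Set.eqOn_union]
        exact ⟨hx ▸ Set.forall_mem_range.2 hστ,
          eqOn_compl_progVars_of_reflTransGen (hsteps.head hstep)⟩
      exact heq ▸ hexit
    · have hstep' := hstep.extend hz fun j => τ (x j)
      refine .whileTrue (BoolExpr.realize_andNe.2 ⟨hstep'.1, fun h => hστ fun j => ?_⟩) hstep'.2 ih
      rw [← hxz σ, h j, z.injective.extend_apply]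

omit [DecidableEq Var] in
theorem exists_realize_iff_reflTransGen_loopStep [Infinite Var] (hexp : Expressive L Var M)
    (D : Decls L Var ar) (p : Assertion L Var) (B : BoolExpr L Var) (S : Stmt L Var ar) :
    ∃ r : Assertion L Var, ∀ τ : Var → M,
      r.Realize τ ↔ ∃ σ, p.Realize σ ∧ Relation.ReflTransGen (LoopStep M D B S) σ τ := by
  classical
  obtain ⟨m, x, hx⟩ := (finite_progVars D (.while B S)).fin_embedding
  obtain ⟨z, hz⟩ := exists_embedding_disjoint_range m
    ((finite_progVars D (.while B S)).union (finite_free p))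
  rw [Set.disjoint_union_right] at hz
  obtain ⟨φ, hφ⟩ := hexp.exists_realize_iff D p (.while (B.andNe x z) S)
  refine ⟨φ.existsVars z, fun τ => ?_⟩
  simp only [realize_existsVars, hφ]
  constructor
  · rintro ⟨d, σ, hσ, hexec⟩
    have hsteps := hexec.reflTransGen_loopStep_extend hz.1 fun j => τ (z j)
    rw [extend_comp_eq (eqOn_extend_of_disjoint disjoint_compl_right d τ)] at hsteps
    exact ⟨_, (realize_extend_of_disjoint hz.2 _ _).2 hσ, hsteps⟩
  · rintro ⟨σ, hσ, hsteps⟩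
    exact ⟨_, _, (realize_extend_of_disjoint hz.2 _ _).2 hσ,
      exec_while_andNe_of_reflTransGen hx hz.1 hsteps⟩

end Loops

section Completeness

variable {L : FirstOrder.Language.{u, v}} {Var : Type w} [DecidableEq Var] {M : Type z}
  [L.Structure M] {n : ℕ} {ar : Fin n → ℕ} {D : Decls L Var ar}
  {Φ : Set (CorrectnessFormula L Var ar)} {k k₁ k₂ : ℕ} {S S₁ S₂ : Stmt L Var ar}

/-- `CoreProvableIn M D Φ k f`: the correctness formula `f` has a proof from `Φ`, without the
RECURSION rule, that consists of at most `k` applications of axioms and proof rules. -/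
def CoreProvableIn (M : Type z) [L.Structure M] (D : Decls L Var ar)
    (Φ : Set (CorrectnessFormula L Var ar)) (k : ℕ) (f : CorrectnessFormula L Var ar) : Prop :=
  ∃ d : Derivation M D .core Φ f, d.size ≤ k

/-- `CoreComplete M D Φ k S`: every true correctness formula about `S` has a proof from `Φ`, without
the RECURSION rule, of size at most `k`. -/
def CoreComplete (M : Type z) [L.Structure M] (D : Decls L Var ar)
    (Φ : Set (CorrectnessFormula L Var ar)) (k : ℕ) (S : Stmt L Var ar) : Prop :=
  ∀ p q, Valid M D p S q → CoreProvableIn M D Φ k ⟨p, S, q⟩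

theorem CoreComplete.mono (h : CoreComplete M D Φ k₁ S) (hk : k₁ ≤ k₂) :
    CoreComplete M D Φ k₂ S := by
  intro p q hpq
  obtain ⟨d, hd⟩ := h p q hpq
  exact ⟨d, hd.trans hk⟩

theorem CoreProvableIn.consequence {p p₁ q₁ q : Assertion L Var}
    (h : CoreProvableIn M D Φ k ⟨p₁, S, q₁⟩)
    (hp : ∀ σ : Var → M, p.Realize σ → p₁.Realize σ)
    (hq : ∀ σ : Var → M, q₁.Realize σ → q.Realize σ) :
    CoreProvableIn M D Φ (k + 1) ⟨p, S, q⟩ := by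
  obtain ⟨d, hd⟩ := h
  exact ⟨.consequence (trueIn_imp.2 hp) (trueIn_imp.2 hq) d, Nat.succ_le_succ hd⟩

theorem CoreProvableIn.invariance {r q : Assertion L Var} (h : CoreProvableIn M D Φ k ⟨r, S, q⟩)
    {p : Assertion L Var} (hp : Disjoint p.free (progChange D S)) :
    CoreProvableIn M D Φ (k + 1) ⟨p ⊓ r, S, p ⊓ q⟩ := by
  obtain ⟨d, hd⟩ := h
  exact ⟨.invariance p hp d, Nat.succ_le_succ hd⟩

theorem CoreProvableIn.existsIntro {p q : Assertion L Var} (h : CoreProvableIn M D Φ k ⟨p, S, q⟩)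
    {m : ℕ} {x : Fin m ↪ Var} (hx : Disjoint (Set.range x) (progVars D S ∪ q.free)) :
    CoreProvableIn M D Φ (k + 1) ⟨p.existsVars x, S, q⟩ := by
  obtain ⟨d, hd⟩ := h
  exact ⟨.existsIntro x hx d, Nat.succ_le_succ hd⟩

/-- The values `d` of the fresh variables `y` record what has to be remembered about the initial
state; the assertion `inv` relates them to variables that `S` does not change. -/
theorem CoreProvableIn.adaptation {a r : Assertion L Var}
    (h : CoreProvableIn M D Φ k ⟨a, S, r⟩) {p q inv : Assertion L Var} {m : ℕ} {y : Fin m ↪ Var}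
    (hy : Disjoint (Set.range y) (progVars D S ∪ q.free))
    (hinv : Disjoint inv.free (progChange D S))
    (hpre : ∀ σ : Var → M, p.Realize σ →
      ∃ d, inv.Realize (Function.extend y d σ) ∧ a.Realize (Function.extend y d σ))
    (hpost : ∀ τ : Var → M, inv.Realize τ → r.Realize τ → q.Realize τ) :
    CoreProvableIn M D Φ (k + 4) ⟨p, S, q⟩ := by
  have hinner : CoreProvableIn M D Φ (k + 2) ⟨inv ⊓ a, S, q⟩ :=
    (h.invariance hinv).consequence (fun _ => id) fun τ hτ =>
      hpost τ (Formula.realize_inf.1 hτ).1 (Formula.realize_inf.1 hτ).2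
  refine (hinner.existsIntro hy).consequence (fun σ hσ => ?_) fun _ => id
  obtain ⟨d, hd⟩ := hpre σ hσ
  exact (realize_existsVars _ _ _).2 ⟨d, Formula.realize_inf.2 hd⟩

theorem coreComplete_skip : CoreComplete M D Φ 2 .skip := by
  intro p q h
  refine CoreProvableIn.consequence ⟨.skip q, le_rfl⟩ (fun σ hσ => ?_) fun _ => id
  exact valid_iff.1 h σ σ hσ (.skip σ)

theorem coreComplete_assign {m : ℕ} (x : Fin m ↪ Var) (t : Fin m → L.Term Var) :
    CoreComplete M D Φ 2 (.assign x t) := by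
  intro p q h
  refine CoreProvableIn.consequence ⟨.assign x t q, le_rfl⟩ (fun σ hσ => ?_) fun _ => id
  exact (realize_substitute _ _ _ _).2 (valid_iff.1 h σ _ hσ (.assign x t σ))

theorem CoreComplete.seq (hexp : Expressive L Var M) (h₁ : CoreComplete M D Φ k₁ S₁)
    (h₂ : CoreComplete M D Φ k₂ S₂) : CoreComplete M D Φ (k₁ + k₂ + 1) (.seq S₁ S₂) := by
  intro p q h
  obtain ⟨r, hr⟩ := hexp.exists_realize_iff D p S₁
  have hpr : Valid M D p S₁ r := valid_iff.2 fun σ ρ hσ e => (hr ρ).2 ⟨σ, hσ, e⟩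
  have hrq : Valid M D r S₂ q := valid_iff.2 fun ρ τ hρ e₂ => by
    obtain ⟨σ, hσ, e₁⟩ := (hr ρ).1 hρ
    exact valid_iff.1 h σ τ hσ (e₁.seq e₂)
  obtain ⟨d₁, hd₁⟩ := h₁ p r hpr
  obtain ⟨d₂, hd₂⟩ := h₂ r q hrq
  exact ⟨.composition d₁ d₂, Nat.succ_le_succ (Nat.add_le_add hd₁ hd₂)⟩

theorem CoreComplete.ite (h₁ : CoreComplete M D Φ k₁ S₁) (h₂ : CoreComplete M D Φ k₂ S₂)
    (B : BoolExpr L Var) : CoreComplete M D Φ (k₁ + k₂ + 1) (.ite B S₁ S₂) := by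
  intro p q h
  have htrue : Valid M D (p ⊓ B.1) S₁ q := valid_iff.2 fun σ τ hσ e =>
    valid_iff.1 h σ τ (Formula.realize_inf.1 hσ).1 (.iteTrue (Formula.realize_inf.1 hσ).2 e)
  have hfalse : Valid M D (p ⊓ B.1.not) S₂ q := valid_iff.2 fun σ τ hσ e =>
    valid_iff.1 h σ τ (Formula.realize_inf.1 hσ).1
      (.iteFalse (Formula.realize_not.1 (Formula.realize_inf.1 hσ).2) e)
  obtain ⟨d₁, hd₁⟩ := h₁ _ q htrue
  obtain ⟨d₂, hd₂⟩ := h₂ _ q hfalse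
  exact ⟨.conditional d₁ d₂, Nat.succ_le_succ (Nat.add_le_add hd₁ hd₂)⟩

theorem CoreComplete.while_loop [Infinite Var] (hexp : Expressive L Var M)
    (h : CoreComplete M D Φ k S) (B : BoolExpr L Var) :
    CoreComplete M D Φ (k + 2) (.while B S) := by
  intro p q hpq
  obtain ⟨r, hr⟩ := exists_realize_iff_reflTransGen_loopStep hexp D p B S
  have hbody : Valid M D (r ⊓ B.1) S r := valid_iff.2 fun ρ τ hρ e => by
    rw [Formula.realize_inf, hr] at hρ
    obtain ⟨⟨σ, hσ, hsteps⟩, hB⟩ := hρ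
    exact (hr τ).2 ⟨σ, hσ, hsteps.tail ⟨hB, e⟩⟩
  obtain ⟨d, hd⟩ := h _ r hbody
  refine CoreProvableIn.consequence ⟨.while d, Nat.succ_le_succ hd⟩
    (fun σ hσ => (hr σ).2 ⟨σ, hσ, .refl⟩) fun τ hτ => ?_
  rw [Formula.realize_inf, hr, Formula.realize_not] at hτ
  obtain ⟨⟨σ, hσ, hsteps⟩, hB⟩ := hτ
  exact valid_iff.1 hpq σ τ hσ (exec_while_of_reflTransGen hsteps hB)

theorem CoreComplete.block [Infinite Var] (hexp : Expressive L Var M)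
    (h : CoreComplete M D Φ k S) {m : ℕ} (x : Fin m ↪ Var) (t : Fin m → L.Term Var) :
    CoreComplete M D Φ (k + 8) (.block x t S) := by
  intro p q hpq
  obtain ⟨y, hy⟩ := exists_embedding_disjoint_range m
    (((finite_progVars D (.block x t S)).union (finite_free p)).union (finite_free q))
  simp only [Set.disjoint_union_right] at hy
  obtain ⟨⟨hyS, hyp⟩, hyq⟩ := hy
  have hyx : Disjoint (Set.range y) (Set.range x) :=
    hyS.mono_right fun _ ha => .inr (.inl (.inl ha))
  have hseq : Valid M D (eqVars x y ⊓ p) (.seq (.assign x t) S)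
      (q.substitute x fun j => Term.var (y j)) := valid_iff.2 fun σ ρ hσ e => by
    rw [Formula.realize_inf, realize_eqVars] at hσ
    have hy_unchanged (j : Fin m) : σ (y j) = ρ (y j) := e.eqOn_compl_progChange fun hj =>
      Set.disjoint_left.1 hyS ⟨j, rfl⟩
        (progChange_subset_progVars D (.seq (.assign x t) S) hj)
    simp only [realize_substitute, Term.realize_var, ← hy_unchanged, ← hσ.1]
    exact valid_iff.1 hpq σ _ hσ.2 (.block e)
  obtain ⟨d, hd⟩ := (coreComplete_assign x t).seq hexp h _ _ hseq
  have hblock : CoreProvableIn M D Φ (k + 4)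
      ⟨eqVars x y ⊓ p, .block x t S, q.substitute x fun j => Term.var (y j)⟩ := by
    have hx_free := (Set.disjoint_union_right.2 ⟨Set.disjoint_sdiff_right, hyx.symm⟩).mono_right
      (free_substitute_var_subset q x y)
    exact ⟨.block hx_free d, (Nat.succ_le_succ hd).trans (by omega)⟩
  refine hblock.adaptation (y := y) (inv := eqVars x y) (Set.disjoint_union_right.2 ⟨hyS, hyq⟩)
    ?_ (fun σ hσ => ⟨fun j => σ (x j), ?_⟩) fun τ hxy hq => ?_
  · exact (Set.disjoint_union_left.2 ⟨Set.disjoint_sdiff_right,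
      hyS.mono_right (progChange_subset_progVars D (.block x t S))⟩).mono_left
        (free_eqVars_subset x y)
  · have hxy : (eqVars x y : Assertion L Var).Realize (Function.extend y (fun j => σ (x j)) σ) :=
      (realize_eqVars _ _ _).2 fun j => by
        rw [eqOn_extend_of_disjoint hyx _ σ ⟨j, rfl⟩, y.injective.extend_apply]
    exact ⟨hxy, Formula.realize_inf.2 ⟨hxy, (realize_extend_of_disjoint hyp _ σ).2 hσ⟩⟩
  · rw [realize_eqVars] at hxy
    simp only [realize_substitute, Term.realize_var, ← hxy] at hq
    rwa [extend_comp_eq fun _ _ => rfl] at hq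

end Completeness

section Calls

variable {L : FirstOrder.Language.{u, v}} {Var : Type w} [DecidableEq Var] {M : Type z}
  [L.Structure M] {n : ℕ} {ar : Fin n → ℕ} {D : Decls L Var ar} {N : ℕ} {x z : Fin N ↪ Var}
  {i : Fin n} {G : Assertion L Var}

/-- `{x = z} P_i(u_i) {G}` is a most general correctness formula: if `x` lists the variables of `D`
and `z` is fresh, then `G` describes all computations of the body of `P_i`, in terms of the initial
values `z` and of the final values of all variables except the parameters `u_i`. -/
structure IsMostGeneralPost (M : Type z) [L.Structure M] (D : Decls L Var ar) (x z : Fin N ↪ Var)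
    (i : Fin n) (G : Assertion L Var) : Prop where
  disjoint_params : Disjoint (Set.range (D.params i)) G.free
  realize_iff (τ : Var → M) : G.Realize τ ↔ ∃ σ ρ, (∀ j, σ (x j) = σ (z j)) ∧
    Exec M D (D.body i) σ ρ ∧ Set.EqOn ρ τ (Set.range (D.params i))ᶜ

theorem exists_isMostGeneralPost (hexp : Expressive L Var M) (D : Decls L Var ar)
    (x z : Fin N ↪ Var) (i : Fin n) : ∃ G, IsMostGeneralPost M D x z i G := by
  obtain ⟨φ, hφ⟩ := hexp.exists_realize_iff D (eqVars x z) (D.body i)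
  refine ⟨φ.existsVars (D.params i), disjoint_free_existsVars _ _, fun τ => ?_⟩
  simp only [realize_existsVars, hφ, realize_eqVars]
  constructor
  · rintro ⟨d, σ, hσ, hexec⟩
    exact ⟨σ, _, hσ, hexec, eqOn_extend_of_disjoint disjoint_compl_right d τ⟩
  · rintro ⟨σ, ρ, hσ, hexec, hρ⟩
    refine ⟨fun j => ρ (D.params i j), σ, hσ, ?_⟩
    rwa [extend_comp_eq hρ.symm]

theorem IsMostGeneralPost.valid_body (hG : IsMostGeneralPost M D x z i G) :
    Valid M D (eqVars x z) (D.body i) G :=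
  valid_iff.2 fun σ τ hσ e =>
    (hG.realize_iff τ).2 ⟨σ, τ, (realize_eqVars _ _ _).1 hσ, e, fun _ _ => rfl⟩

theorem IsMostGeneralPost.exists_exec_of_realize_substitute (hG : IsMostGeneralPost M D x z i G)
    (hz : Disjoint (Set.range z) D.vars) {z' : Fin N → Var} {τ : Var → M}
    (hτ : (G.substitute z fun j => Term.var (z' j)).Realize τ) :
    ∃ σ ρ : Var → M, (∀ j, σ (x j) = τ (z' j)) ∧ Exec M D (D.body i) σ ρ ∧
      Set.EqOn ρ τ (D.vars \ Set.range (D.params i)) := by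
  obtain ⟨σ, ρ, hσ, hexec, hρ⟩ := (hG.realize_iff _).1 ((realize_substitute _ _ _ _).1 hτ)
  refine ⟨σ, ρ, fun j => ?_, hexec, fun a ha => ?_⟩
  · have hzj : z j ∉ D.vars := Set.disjoint_left.1 hz ⟨j, rfl⟩
    rw [hσ j, hexec.eqOn_compl_progChange fun h =>
        hzj (D.change_subset_vars (D.changeWith_body_subset i h)),
      hρ fun h => hzj (D.params_subset_vars i h), z.injective.extend_apply, Term.realize_var]
  · rw [hρ ha.2, eqOn_extend_of_disjoint hz _ _ ha.1]

omit [DecidableEq Var] in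
theorem realize_eqVars_substitute_substitute (hzx : Disjoint (Set.range z) (Set.range x))
    {m : ℕ} {u : Fin m ↪ Var} {z' : Fin N → Var} (hu : Disjoint (Set.range z') (Set.range u))
    (t : Fin m → L.Term Var) (σ : Var → M) :
    (((eqVars x z).substitute z fun j => Term.var (z' j)).substitute u t).Realize σ ↔
      ∀ j, Function.extend u (fun j => (t j).realize σ) σ (x j) = σ (z' j) := by
  rw [realize_substitute, realize_substitute, realize_eqVars]
  refine forall_congr' fun j => ?_
  rw [eqOn_extend_of_disjoint hzx _ _ ⟨j, rfl⟩, z.injective.extend_apply, Term.realize_var,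
    eqOn_extend_of_disjoint hu.symm _ σ ⟨j, rfl⟩]

theorem progVars_genericCall (D : Decls L Var ar) (i : Fin n) :
    progVars D (D.genericCall i) = D.vars := by
  refine Set.union_eq_self_of_subset_right (Set.iUnion_subset fun j a ha => ?_)
  rw [Finset.mem_coe.1 ha |> Finset.mem_singleton.1]
  exact D.params_subset_vars i ⟨j, rfl⟩

theorem coreProvableIn_call_of_mem {Φ : Set (CorrectnessFormula L Var ar)} {p q : Assertion L Var}
    (hΦ : ⟨p, D.genericCall i, q⟩ ∈ Φ) (hq : Disjoint (Set.range (D.params i)) q.free)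
    (hz : Disjoint (Set.range z) D.vars) {z' : Fin N → Var}
    (hz' : Disjoint (Set.range z') D.vars) (t : Fin (ar i) → L.Term Var) :
    CoreProvableIn M D Φ 2
      ⟨(p.substitute z fun j => Term.var (z' j)).substitute (D.params i) t, .call i t,
        q.substitute z fun j => Term.var (z' j)⟩ := by
  have hq' : Disjoint (Set.range (D.params i)) (q.substitute z fun j => Term.var (z' j)).free :=
    (Set.disjoint_union_right.2 ⟨hq.mono_right Set.sdiff_subset,
      (hz'.mono_right (D.params_subset_vars i)).symm⟩).mono_right
        (free_substitute_var_subset q z z')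
  rw [← progVars_genericCall D i] at hz hz'
  exact ⟨.procedureCall t hq' (.substitution z z' hz
    (hz'.mono_right (progChange_subset_progVars D _)) (.assumption hΦ)), le_rfl⟩

/-- Replacing the variables that may change by variables that record their values yields an
assertion to which the INVARIANCE rule applies. -/
theorem exists_invariant_of_record {c : Set Var} (hc : c ⊆ Set.range x) {z' : Fin N ↪ Var}
    (hz' : Disjoint (Set.range z') c) (A : Assertion L Var) :
    ∃ inv : Assertion L Var, Disjoint inv.free c ∧
      (∀ σ : Var → M, A.Realize σ → (∀ j, x j ∈ c → σ (x j) = σ (z' j)) → inv.Realize σ) ∧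
      ∀ τ : Var → M, inv.Realize τ → ∃ σ, A.Realize σ ∧ Set.EqOn σ τ cᶜ := by
  obtain ⟨m, ι, hι⟩ := (Set.toFinite {j | x j ∈ c}).fin_embedding
  have hrange : Set.range (ι.trans x) = c := by
    rw [Function.Embedding.coe_trans, Set.range_comp, hι]
    exact Set.image_preimage_eq_of_subset hc
  refine ⟨A.substitute (ι.trans x) fun j => Term.var (z' (ι j)), ?_, fun σ hσ hrec => ?_,
    fun τ hτ => ⟨_, (realize_substitute _ _ _ _).1 hτ, ?_⟩⟩
  · refine Disjoint.mono_left (free_substitute_var_subset _ _ _)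
      (Set.disjoint_union_left.2 ⟨?_, ?_⟩)
    · rw [hrange]
      exact Set.disjoint_sdiff_left
    · exact hz'.mono_left (Set.range_comp_subset_range ι z')
  · have hval : (fun j => σ (z' (ι j))) = fun j => σ (ι.trans x j) :=
      funext fun j => (hrec (ι j) (hι.subset ⟨j, rfl⟩)).symm
    simp only [realize_substitute, Term.realize_var]
    rwa [hval, extend_comp_eq fun _ _ => rfl]
  · exact eqOn_extend_of_disjoint (hrange ▸ disjoint_compl_right) _ τ

theorem IsMostGeneralPost.coreComplete_call [Infinite Var] {Φ : Set (CorrectnessFormula L Var ar)}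
    (hG : IsMostGeneralPost M D x z i G) (hx : Set.range x = D.vars)
    (hz : Disjoint (Set.range z) D.vars) (hΦ : ⟨eqVars x z, D.genericCall i, G⟩ ∈ Φ)
    (t : Fin (ar i) → L.Term Var) : CoreComplete M D Φ 6 (.call i t) := by
  intro p q h
  obtain ⟨z', hz'⟩ := exists_embedding_disjoint_range N
    (((finite_progVars D (.call i t)).union (finite_free p)).union (finite_free q))
  simp only [Set.disjoint_union_right] at hz'
  obtain ⟨⟨hz'S, hz'p⟩, hz'q⟩ := hz'
  have hz'D : Disjoint (Set.range z') D.vars := hz'S.mono_right Set.subset_union_left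
  have hz't : Disjoint (Set.range z') (termVars t) := hz'S.mono_right Set.subset_union_right
  have hcD : progChange D (.call i t) ⊆ D.vars := Set.sdiff_subset.trans D.change_subset_vars
  have hE := realize_eqVars_substitute_substitute (M := M) (x := x) (hx ▸ hz)
    (hz'D.mono_right (D.params_subset_vars i)) t
  obtain ⟨inv, hinv, hinv_of, of_hinv⟩ := exists_invariant_of_record (M := M) (hcD.trans hx.ge)
    (hz'D.mono_right hcD) (p ⊓
      ((eqVars x z).substitute z fun j => Term.var (z' j)).substitute (D.params i) t)
  simp only [Formula.realize_inf, hE] at hinv_of of_hinv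
  refine (coreProvableIn_call_of_mem hΦ hG.disjoint_params hz hz'D t).adaptation
    (Set.disjoint_union_right.2 ⟨hz'S, hz'q⟩) hinv (fun σ hσ => ?_) fun τ hτ hGτ => ?_
  · let d (j : Fin N) : M := Function.extend (D.params i) (fun j => (t j).realize σ) σ (x j)
    have hstart (j : Fin N) : Function.extend (D.params i)
        (fun j => (t j).realize (Function.extend z' d σ)) (Function.extend z' d σ) (x j) =
          Function.extend z' d σ (z' j) := by
      rw [realize_terms_congr (eqOn_extend_of_disjoint hz't d σ), z'.injective.extend_apply]
      exact eqOn_extend (eqOn_extend_of_disjoint (hx ▸ hz'D) d σ) _ _ (Set.mem_range_self j)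
    refine ⟨d, hinv_of _ ⟨(realize_extend_of_disjoint hz'p d σ).2 hσ, hstart⟩ fun j hj => ?_,
      (hE _).2 hstart⟩
    rw [← hstart j, Function.extend_apply' _ _ _ hj.2]
  · obtain ⟨σ, ⟨hσ, hstart⟩, hστ⟩ := of_hinv τ hτ
    obtain ⟨ρ, ρ', hρ, hexec, hρ'⟩ := hG.exists_exec_of_realize_substitute hz hGτ
    refine valid_iff.1 h σ τ hσ (exec_call_of_body hexec ?_ hρ' hστ)
    rw [← hx]
    rintro _ ⟨j, rfl⟩
    rw [hρ, hstart, hστ (Set.disjoint_left.1 (hz'D.mono_right hcD) ⟨j, rfl⟩)]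

end Calls

section Recursion

variable {L : FirstOrder.Language.{u, v}} {Var : Type w} [DecidableEq Var]
  {M : Type z} [L.Structure M] {n : ℕ} {ar : Fin n → ℕ} {D : Decls L Var ar}

theorem coreComplete_of_isMostGeneralPost [Infinite Var] {Φ : Set (CorrectnessFormula L Var ar)}
    (hexp : Expressive L Var M) {N : ℕ} {x z : Fin N ↪ Var} (hx : Set.range x = D.vars)
    (hz : Disjoint (Set.range z) D.vars) {G : Fin n → Assertion L Var}
    (hG : ∀ i, IsMostGeneralPost M D x z i (G i))
    (hΦ : ∀ i, ⟨eqVars x z, D.genericCall i, G i⟩ ∈ Φ) :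
    ∀ S : Stmt L Var ar, CoreComplete M D Φ (6 * S.len) S
  | .skip => coreComplete_skip.mono (by simp only [Stmt.len]; omega)
  | .assign x t => (coreComplete_assign x t).mono (by simp only [Stmt.len]; omega)
  | .call i t => (hG i).coreComplete_call hx hz (hΦ i) t
  | .seq S₁ S₂ =>
    (CoreComplete.seq hexp (coreComplete_of_isMostGeneralPost hexp hx hz hG hΦ S₁)
      (coreComplete_of_isMostGeneralPost hexp hx hz hG hΦ S₂)).mono
        (by simp only [Stmt.len]; omega)
  | .ite B S₁ S₂ =>
    ((coreComplete_of_isMostGeneralPost hexp hx hz hG hΦ S₁).ite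
      (coreComplete_of_isMostGeneralPost hexp hx hz hG hΦ S₂) B).mono
        (by simp only [Stmt.len]; omega)
  | .while B S =>
    ((coreComplete_of_isMostGeneralPost hexp hx hz hG hΦ S).while_loop hexp B).mono
      (by simp only [Stmt.len]; omega)
  | .block y t S =>
    ((coreComplete_of_isMostGeneralPost hexp hx hz hG hΦ S).block hexp y t).mono
      (by simp only [Stmt.len]; omega)

theorem provableIn_of_coreComplete {c : ℕ} {pre post : Fin n → Assertion L Var}
    (hpost : ∀ i, Disjoint (Set.range (D.params i)) (post i).free)
    (hbody : ∀ i, Valid M D (pre i) (D.body i) (post i))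
    (hcore : ∀ S, CoreComplete M D (Set.range fun i => ⟨pre i, D.genericCall i, post i⟩)
      (c * S.len) S)
    {p q : Assertion L Var} {T : Stmt L Var ar} (h : Valid M D p T q)
    (Φ : Set (CorrectnessFormula L Var ar)) :
    ProvableIn M D Φ ((c + 1) * progLen D T) ⟨p, T, q⟩ := by
  obtain ⟨d, hd⟩ := hcore T p q h
  choose e he using fun i => hcore (D.body i) _ _ (hbody i)
  refine ⟨.recursion pre post hpost d e, ?_⟩
  calc d.size + ∑ i, (e i).size + 1
      ≤ c * T.len + ∑ i, c * (D.body i).len + T.len :=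
        Nat.add_le_add (Nat.add_le_add hd (Finset.sum_le_sum fun i _ => he i)) T.one_le_len
    _ = c * progLen D T + T.len := by rw [← Finset.mul_sum, progLen]; ring
    _ ≤ (c + 1) * progLen D T := by rw [add_one_mul]; gcongr; exact Nat.le_add_left _ _

end Recursion

end CBV

theorem mainTheorem2 :
    ∃ C : ℕ, ∀ (L : FirstOrder.Language.{u, v}) (Var : Type w) [DecidableEq Var] [Infinite Var]
      (M : Type z) [L.Structure M] [Nonempty M],
      CBV.Expressive L Var M →
      ∀ (n : ℕ) (ar : Fin n → ℕ) (D : CBV.Decls L Var ar) (T : CBV.Stmt L Var ar)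
        (p q : CBV.Assertion L Var),
        CBV.Valid M D p T q →
        CBV.ProvableIn M D ∅ (C * CBV.progLen D T) ⟨p, T, q⟩ := by
  refine ⟨7, fun L Var _ _ M _ _ hexp n ar D T p q h => ?_⟩
  obtain ⟨N, x, hx⟩ := D.finite_vars.fin_embedding
  obtain ⟨z, hz⟩ := CBV.exists_embedding_disjoint_range N D.finite_vars
  choose G hG using CBV.exists_isMostGeneralPost hexp D x z
  have hcore := CBV.coreComplete_of_isMostGeneralPost hexp hx hz hG fun i => Set.mem_range_self i
  exact CBV.provableIn_of_coreComplete (fun i => (hG i).disjoint_params)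
    (fun i => (hG i).valid_body) hcore h ∅
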